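/- A directed graph $G$ with finite vertex set $V$ has a graceful difference labeling if there is a bijection $f:V\to\{1,\ldots,|V|\}$ such that the integers $f(v)-f(u)$, taken over all arcs $uv$ of $G$, are pairwise distinct. For $k\ge 2$ let $\overrightarrow{C_k}$ be the circuit with vertices $v_1,\ldots,v_k$ and arcs $v_1v_2,\ldots,v_{k-1}v_k,v_kv_1$, and let $+$ denote disjoint union. Theorem. Let $G$ be a disjoint union of finitely many circuits, each of length at least $2$, such that either at most one of the circuits has odd length, or every circuit of odd length has length $3$. Then $G$ has a graceful difference labeling if and only if $G$ is isomorphic neither to $\overrightarrow{C_3}$ nor to $\overrightarrow{C_2}+\overrightarrow{C_3}$. -/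

import Mathlib

namespace Digraph

/-- Isomorphism of directed graphs: a bijection of the vertex sets under which
`uv` is an arc of `G` if and only if the image of `uv` is an arc of `H`. -/
def IsIso {V W : Type*} (G : Digraph V) (H : Digraph W) : Prop :=
  Nonempty (G.Adj ≃r H.Adj)

/-- The circuit (directed cycle) on the `k` vertices `0, …, k - 1`, with arcs
`0 → 1 → ⋯ → k - 1 → 0`. It is used only for `2 ≤ k`. -/
def circuit (k : ℕ) : Digraph (Fin k) where
  Adj i j := (j : ℕ) = ((i : ℕ) + 1) % k

/-- The disjoint union of a family of directed graphs: the vertex set is the disjoint union of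
the vertex sets, and the arcs are exactly the arcs of the members of the family. -/
def disjointUnion {ι : Type*} {V : ι → Type*} (G : ∀ i, Digraph (V i)) :
    Digraph (Σ i, V i) where
  Adj u v := ∃ (i : ι) (x y : V i), (G i).Adj x y ∧ u = ⟨i, x⟩ ∧ v = ⟨i, y⟩

/-- The disjoint union of `m` circuits, of lengths `k 0, …, k (m - 1)`. -/
def circuitUnion {m : ℕ} (k : Fin m → ℕ) : Digraph (Σ i, Fin (k i)) :=
  disjointUnion fun i => circuit (k i)

/-- `f` is a graceful difference labeling of the (finite) directed graph `G`: it is a bijection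
from the vertex set onto `{1, …, |V|}`, and distinct arcs `uv` have distinct difference labels
`f v - f u` (integers). -/
def IsGracefulDifferenceLabeling {V : Type*} (G : Digraph V) (f : V → ℕ) : Prop :=
  Set.BijOn f Set.univ (Set.Icc 1 (Nat.card V)) ∧
    ∀ u v u' v' : V, G.Adj u v → G.Adj u' v' →
      (f v : ℤ) - (f u : ℤ) = (f v' : ℤ) - (f u' : ℤ) → u = u' ∧ v = v'

/-- `G` has a graceful difference labeling. -/
def HasGracefulDifferenceLabeling {V : Type*} (G : Digraph V) : Prop :=
  ∃ f : V → ℕ, G.IsGracefulDifferenceLabeling f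

end Digraph

/-! The proof nests labellings concentrically. A labelling by `1, …, n` has differences of absolute
value at most `n - 1`. Shift it up and put further circuits on labels below and above it: if they
always jump between the low and the high side, their differences have absolute value at least `n`
and nothing collides (`Labeled.nest`, `Graceful.add`). A circuit of length `2 * p` can be wrapped
around in this way if `p` is odd or `p ≥ 4`. A 4-circuit alone cannot, but two of them together can.
So if both `s` and `s + {4}` are graceful, arbitrary even circuits may be added to `s`
(`Graceful.add_all_even`), and it remains to find base labellings that contain the odd circuits.

The bases are: no circuit; one odd circuit of length at least 5; at least two triangles; each also
together with a 4-circuit. A single triangle is not graceful, nor is it with one 2-circuit, so there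
the base must include a longer even circuit or two 2-circuits (`graceful_three_add_even`).

For many triangles, four arithmetic families label `4 * u` triangles by `1, …, 12 * u` with all
differences at least `u` in absolute value (`labeled_triangles_four_mul`). If `u ≥ 3`, the
differences `±1, ±2` stay free, and up to three remaining triangles and possibly a 4-circuit are
wrapped around the block with their help. Fewer than 12 triangles are handled by explicit tables.
Conversely, the two exceptional digraphs are excluded by finite checks. -/

namespace Digraph

/-! ### Labellings of families of circuits -/

/-- The differences along the arcs of a circuit whose vertices carry the labels `l`, in order. -/
def cycDiffs (l : List ℤ) : List ℤ := List.zipWith (fun a b => b - a) l (l.rotate 1)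

/-- The circuits whose lengths are listed in `s` can be labelled bijectively with the elements of
`A` in such a way that the differences along the arcs are pairwise distinct and lie in `D`. -/
def Labeled (s : Multiset ℕ) (A D : Set ℤ) : Prop :=
  ∃ L : List (List ℤ), ((L.map List.length : List ℕ) : Multiset ℕ) = s ∧ L.flatten.Nodup ∧
    (∀ x, x ∈ L.flatten ↔ x ∈ A) ∧ (L.flatMap cycDiffs).Nodup ∧ ∀ d ∈ L.flatMap cycDiffs, d ∈ D

/-- The disjoint union of circuits of lengths `s` has a graceful difference labeling. -/
def Graceful (s : Multiset ℕ) : Prop := Labeled s (Set.Icc 1 (s.sum : ℤ)) Set.univ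

@[simp] theorem length_cycDiffs (l : List ℤ) : (cycDiffs l).length = l.length := by
  simp [cycDiffs]

theorem getElem_cycDiffs (l : List ℤ) (i : ℕ) (h : i < (cycDiffs l).length) :
    (cycDiffs l)[i] = l[(i + 1) % l.length]'(Nat.mod_lt _ (by
      have := length_cycDiffs l; omega)) - l[i]'(by simpa using h) := by
  simp [cycDiffs, List.getElem_rotate]

theorem exists_sub_of_mem_cycDiffs {l : List ℤ} {d : ℤ} (h : d ∈ cycDiffs l) :
    ∃ x ∈ l, ∃ y ∈ l, d = y - x := by
  obtain ⟨i, hi, rfl⟩ := List.mem_iff_getElem.1 h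
  rw [getElem_cycDiffs]
  exact ⟨_, List.getElem_mem _, _, List.getElem_mem _, rfl⟩

theorem cycDiffs_map_add (l : List ℤ) (c : ℤ) : cycDiffs (l.map (· + c)) = cycDiffs l := by
  apply List.ext_getElem
  · simp
  · intro i h1 h2
    simp [getElem_cycDiffs]

theorem Labeled.mono {s : Multiset ℕ} {A D D' : Set ℤ} (h : Labeled s A D) (hD : D ⊆ D') :
    Labeled s A D' := by
  obtain ⟨L, h1, h2, h3, h4, h5⟩ := h
  exact ⟨L, h1, h2, h3, h4, fun d hd => hD (h5 d hd)⟩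

theorem Labeled.congr {s s' : Multiset ℕ} {A A' D : Set ℤ} (h : Labeled s A D) (hs : s = s')
    (hA : ∀ x, x ∈ A ↔ x ∈ A') : Labeled s' A' D := by
  obtain rfl : A = A' := Set.ext hA
  exact hs ▸ h

theorem Labeled.zero (D : Set ℤ) : Labeled 0 ∅ D := ⟨[], by simp⟩

theorem Labeled.add {s s' : Multiset ℕ} {A A' D D' : Set ℤ} (h : Labeled s A D)
    (h' : Labeled s' A' D') (hA : ∀ x ∈ A, x ∉ A') (hD : ∀ x ∈ D, x ∉ D') :
    Labeled (s + s') (A ∪ A') (D ∪ D') := by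
  obtain ⟨L, h1, h2, h3, h4, h5⟩ := h
  obtain ⟨L', h1', h2', h3', h4', h5'⟩ := h'
  refine ⟨L ++ L', ?_, ?_, ?_, ?_, ?_⟩
  · rw [List.map_append, ← Multiset.coe_add, h1, h1']
  · rw [List.flatten_append]
    refine h2.append h2' fun x hx hx' => ?_
    exact hA x ((h3 x).1 hx) ((h3' x).1 hx')
  · intro x
    rw [List.flatten_append, List.mem_append, h3, h3', Set.mem_union]
  · rw [List.flatMap_append]
    refine h4.append h4' fun x hx hx' => ?_
    exact hD x (h5 x hx) (h5' x hx')
  · intro d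
    rw [List.flatMap_append, List.mem_append]
    rintro (hd | hd)
    · exact Or.inl (h5 d hd)
    · exact Or.inr (h5' d hd)

theorem Labeled.translate {s : Multiset ℕ} {A D : Set ℤ} (h : Labeled s A D) (c : ℤ) :
    Labeled s {x | x - c ∈ A} D := by
  obtain ⟨L, h1, h2, h3, h4, h5⟩ := h
  have hd : (L.map (List.map (· + c))).flatMap cycDiffs = L.flatMap cycDiffs := by
    rw [List.flatMap_map]
    simp only [cycDiffs_map_add]
  refine ⟨L.map (List.map (· + c)), ?_, ?_, ?_, by rwa [hd], by rwa [hd]⟩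
  · rw [← h1]; simp [Function.comp_def]
  · rw [← List.map_flatten]
    exact h2.map (add_left_injective c)
  · intro x
    rw [← List.map_flatten, Set.mem_ofPred_eq, ← h3, List.mem_map]
    constructor
    · rintro ⟨y, hy, rfl⟩; simpa using hy
    · intro hx; exact ⟨_, hx, by ring⟩

/-- Differences of labels from an interval are bounded by its length. -/
theorem Labeled.bounded {s : Multiset ℕ} {a b : ℤ} {D : Set ℤ} (h : Labeled s (Set.Icc a b) D) :
    Labeled s (Set.Icc a b) {d | d ∈ D ∧ a - b ≤ d ∧ d ≤ b - a} := by
  obtain ⟨L, h1, h2, h3, h4, h5⟩ := h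
  refine ⟨L, h1, h2, h3, h4, fun d hd => ⟨h5 d hd, ?_⟩⟩
  obtain ⟨l, hl, hd⟩ := List.mem_flatMap.1 hd
  obtain ⟨x, hx, y, hy, rfl⟩ := exists_sub_of_mem_cycDiffs hd
  have hx' := (h3 x).1 (List.mem_flatten.2 ⟨l, hl, hx⟩)
  have hy' := (h3 y).1 (List.mem_flatten.2 ⟨l, hl, hy⟩)
  simp only [Set.mem_Icc] at hx' hy'
  omega

/-- A labelled circuit, given by the labels `g 0, …, g (k - 1)` of its vertices. -/
theorem Labeled.circuit {k : ℕ} (g : ℕ → ℤ) (hk : g k = g 0)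
    (hg : ∀ v w, v < k → w < k → g v = g w → v = w)
    (hd : ∀ v w, v < k → w < k → g (v + 1) - g v = g (w + 1) - g w → v = w) :
    Labeled {k} {x | ∃ v < k, x = g v} {d | ∃ v < k, d = g (v + 1) - g v} := by
  have hc : cycDiffs ((List.range k).map g) = (List.range k).map fun v => g (v + 1) - g v := by
    apply List.ext_getElem
    · simp
    · intro i h1 h2
      have hi : i < k := by simpa using h1
      rw [getElem_cycDiffs]
      simp only [List.getElem_map, List.getElem_range, List.length_map, List.length_range]
      rcases Nat.lt_or_ge (i + 1) k with h | h
      · rw [Nat.mod_eq_of_lt h]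
      · obtain rfl : k = i + 1 := by omega
        rw [Nat.mod_self, hk]
  refine ⟨[(List.range k).map g], by simp, ?_, ?_, ?_, ?_⟩
  · rw [List.flatten_singleton]
    refine List.Nodup.map_on ?_ List.nodup_range
    intro x hx y hy
    exact hg x y (List.mem_range.1 hx) (List.mem_range.1 hy)
  · intro x
    simp [eq_comm]
  · rw [List.flatMap_singleton, hc]
    refine List.Nodup.map_on ?_ List.nodup_range
    intro x hx y hy
    exact hd x y (List.mem_range.1 hx) (List.mem_range.1 hy)
  · intro d
    rw [List.flatMap_singleton, hc]
    simp only [List.mem_map, List.mem_range, Set.mem_ofPred_eq]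
    rintro ⟨v, hv, rfl⟩
    exact ⟨v, hv, rfl⟩

/-- Surjectivity is a matter of counting: there are `s.sum` distinct labels, all in an interval with
`s.sum` elements. Explicit tables thus need only decidable checks. -/
theorem graceful_of_list (L : List (List ℤ)) {s : Multiset ℕ}
    (hs : ((L.map List.length : List ℕ) : Multiset ℕ) = s) (h : L.flatten.Nodup)
    (hr : ∀ x ∈ L.flatten, x ∈ Finset.Icc (1 : ℤ) s.sum) (hd : (L.flatMap cycDiffs).Nodup) :
    Graceful s := by
  refine ⟨L, hs, h, fun x => ⟨fun hx => by simpa using hr x hx, fun hx => ?_⟩, hd, by simp⟩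
  have h1 : L.flatten.toFinset ⊆ Finset.Icc (1 : ℤ) s.sum := fun x hx =>
    hr x (List.mem_toFinset.1 hx)
  have h2 : (Finset.Icc (1 : ℤ) s.sum).card ≤ L.flatten.toFinset.card := by
    rw [List.toFinset_card_of_nodup h, Int.card_Icc, List.length_flatten, ← hs,
      Multiset.sum_coe]
    omega
  have h3 := Finset.eq_of_subset_of_card_le h1 h2
  rw [← List.mem_toFinset, h3]
  simpa using hx

/-! ### From list labellings to labelings of digraphs -/

/-- Applied twice in `Graceful.circuitUnion`: to the lists of labels, for injectivity on vertices,
and to the lists of differences, where a position stands for an arc. -/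
theorem getElem_getElem_injective {M : List (List ℤ)} (h : M.flatten.Nodup) {i j x y : ℕ}
    (hi : i < M.length) (hj : j < M.length) (hx : x < M[i].length) (hy : y < M[j].length)
    (he : M[i][x] = M[j][y]) : i = j ∧ x = y := by
  obtain ⟨h1, h2⟩ := List.nodup_flatten.1 h
  rw [List.pairwise_iff_getElem] at h2
  rcases Nat.lt_trichotomy i j with hij | rfl | hij
  · exact (h2 i j hi hj hij (List.getElem_mem hx) (he ▸ List.getElem_mem hy)).elim
  · exact ⟨rfl, (h1 _ (List.getElem_mem hi)).getElem_inj_iff.1 he⟩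
  · exact (h2 j i hj hi hij (List.getElem_mem hy) (he ▸ List.getElem_mem hx)).elim

/-- Lengths are known only as a multiset; this reorders the labelled circuits so that the `i`-th one
has length `k i`. -/
theorem exists_perm_of_map_perm {α β : Type*} (f : α → β) {l : List α} {b : List β}
    (h : (l.map f).Perm b) : ∃ l' : List α, l'.Perm l ∧ l'.map f = b := by
  classical
  induction b generalizing l with
  | nil => exact ⟨[], by simpa [eq_comm] using h, rfl⟩
  | cons y b ih =>
    obtain ⟨x, hx, rfl⟩ := List.mem_map.1 (h.mem_iff.2 List.mem_cons_self)
    have hp := List.perm_cons_erase hx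
    have h2 : ((l.erase x).map f).Perm b := by
      have := (hp.map f).symm.trans h
      rw [List.map_cons] at this
      exact (List.perm_cons _).1 this
    obtain ⟨l', h3, h4⟩ := ih h2
    exact ⟨x :: l', (h3.cons x).trans hp.symm, by simp [h4]⟩

theorem HasGracefulDifferenceLabeling.of_isIso {V W : Type*} {G : Digraph V} {H : Digraph W}
    (h : G.IsIso H) (hH : H.HasGracefulDifferenceLabeling) : G.HasGracefulDifferenceLabeling := by
  obtain ⟨e⟩ := h
  obtain ⟨f, hf, hd⟩ := hH
  refine ⟨f ∘ e, ?_, ?_⟩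
  · rw [Nat.card_congr e.toEquiv]
    exact hf.comp (Set.bijOn_univ.2 e.bijective)
  · intro u v u' v' huv huv' he
    obtain ⟨h1, h2⟩ := hd _ _ _ _ (e.map_rel_iff.2 huv) (e.map_rel_iff.2 huv') he
    exact ⟨e.injective h1, e.injective h2⟩

theorem IsIso.symm {V W : Type*} {G : Digraph V} {H : Digraph W} (h : G.IsIso H) : H.IsIso G :=
  h.map RelIso.symm

theorem IsIso.trans {U V W : Type*} {G : Digraph U} {H : Digraph V} {K : Digraph W}
    (h : G.IsIso H) (h' : H.IsIso K) : G.IsIso K := by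
  obtain ⟨e⟩ := h
  obtain ⟨e'⟩ := h'
  exact ⟨e.trans e'⟩

theorem Graceful.circuitUnion {m : ℕ} {k : Fin m → ℕ}
    (h : Graceful (Finset.univ.val.map k)) :
    (circuitUnion k).HasGracefulDifferenceLabeling := by
  obtain ⟨L₀, h1, h2, h3, h4, -⟩ := h
  have hk : ((List.ofFn k : List ℕ) : Multiset ℕ) = Finset.univ.val.map k := by
    simp [Fin.univ_def, List.ofFn_eq_map]
  have hp : (L₀.map List.length).Perm (List.ofFn k) := by
    rw [← Multiset.coe_eq_coe, h1, hk]
  obtain ⟨L, hL, hLk⟩ := exists_perm_of_map_perm _ hp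
  have hn : L.flatten.Nodup := hL.flatten.nodup_iff.2 h2
  have hn' : (L.map cycDiffs).flatten.Nodup := by
    rw [← List.flatMap_def]
    exact (hL.flatMap_right cycDiffs).nodup_iff.2 h4
  have hmem : ∀ x, x ∈ L.flatten ↔ x ∈ Set.Icc (1 : ℤ) ((Finset.univ.val.map k).sum : ℕ) :=
    fun x => by rw [hL.flatten.mem_iff, h3]
  have hlen : L.length = m := by simpa using congrArg List.length hLk
  have hki : ∀ i : Fin m, (L[(i : ℕ)]'(by omega)).length = k i := by
    intro i
    have : (L.map List.length)[(i : ℕ)]'(by simp; omega) = (List.ofFn k)[(i : ℕ)]'(by simp) := by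
      simp only [hLk]
    simpa using this
  have hcard : Nat.card (Σ i, Fin (k i)) = (Finset.univ.val.map k).sum := by
    simp [List.sum_ofFn]
  let g : (Σ i, Fin (k i)) → ℤ := fun v => (L[(v.1 : ℕ)]'(by omega))[(v.2 : ℕ)]'(by
    rw [hki]; exact v.2.2)
  have hg : ∀ v, g v ∈ L.flatten := fun v =>
    List.mem_flatten.2 ⟨_, List.getElem_mem _, List.getElem_mem _⟩
  have hg1 : ∀ v, 1 ≤ g v ∧ g v ≤ ((Finset.univ.val.map k).sum : ℕ) := fun v => by
    simpa using (hmem _).1 (hg v)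
  have hcast : ∀ v, (((g v).toNat : ℕ) : ℤ) = g v := fun v =>
    Int.toNat_of_nonneg (by have := hg1 v; omega)
  refine ⟨fun v => (g v).toNat, ⟨?_, ?_, ?_⟩, ?_⟩
  · intro v _
    have := hg1 v
    rw [hcard, Set.mem_Icc]
    dsimp only
    omega
  · intro v _ w _ hvw
    have hvw' : g v = g w := by rw [← hcast, ← hcast w]; exact congrArg _ hvw
    obtain ⟨i, x⟩ := v
    obtain ⟨j, y⟩ := w
    obtain ⟨hi, hx⟩ := getElem_getElem_injective hn _ _ _ _ hvw'
    obtain rfl := Fin.ext hi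
    obtain rfl := Fin.ext hx
    rfl
  · intro x hx
    rw [hcard, Set.mem_Icc] at hx
    have hx' : (x : ℤ) ∈ L.flatten := (hmem _).2 (by simp only [Set.mem_Icc]; omega)
    obtain ⟨l, hl, hxl⟩ := List.mem_flatten.1 hx'
    obtain ⟨i, hi, rfl⟩ := List.mem_iff_getElem.1 hl
    obtain ⟨j, hj, hxj⟩ := List.mem_iff_getElem.1 hxl
    have hk' := hki ⟨i, by omega⟩
    refine ⟨⟨⟨i, by omega⟩, ⟨j, ?_⟩⟩, trivial, ?_⟩
    · rw [← hk']; exact hj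
    · show (L[i][j]).toNat = x
      rw [hxj]; simp
  · rintro u v u' v' ⟨i, x, y, hxy, rfl, rfl⟩ ⟨j, x', y', hxy', rfl, rfl⟩ he
    simp only [hcast] at he
    have hdiff : ∀ (i : Fin m) (x y : Fin (k i)), (y : ℕ) = ((x : ℕ) + 1) % k i →
        g ⟨i, y⟩ - g ⟨i, x⟩ = ((L.map cycDiffs)[(i : ℕ)]'(by simp; omega))[(x : ℕ)]'(by
          rw [List.getElem_map, length_cycDiffs, hki]; exact x.2) := by
      intro i x y hxy
      simp only [List.getElem_map, getElem_cycDiffs, g, hxy, hki]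
    rw [hdiff i x y hxy, hdiff j x' y' hxy'] at he
    obtain ⟨hi, hx⟩ := getElem_getElem_injective hn' _ _ _ _ he
    obtain rfl := Fin.ext hi
    obtain rfl := Fin.ext hx
    obtain rfl : y = y' := Fin.ext (hxy.trans hxy'.symm)
    exact ⟨rfl, rfl⟩

/-! ### Circuits alternating between low and high labels -/

/-- The sequence `lo 0, hi 0, lo 1, hi 1, …`. -/
def alternate (lo hi : ℕ → ℤ) (v : ℕ) : ℤ := if v % 2 = 0 then lo (v / 2) else hi (v / 2)

theorem alternate_even (lo hi : ℕ → ℤ) (i : ℕ) : alternate lo hi (2 * i) = lo i := by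
  simp [alternate]

theorem alternate_odd (lo hi : ℕ → ℤ) (i : ℕ) : alternate lo hi (2 * i + 1) = hi i := by
  have h : (2 * i + 1) / 2 = i := by omega
  simp [alternate, h]

theorem alternate_odd_succ (lo hi : ℕ → ℤ) (i : ℕ) :
    alternate lo hi (2 * i + 1 + 1) = lo (i + 1) := by
  rw [show 2 * i + 1 + 1 = 2 * (i + 1) by ring, alternate_even]

/-- A circuit of even length that alternates between low labels `lo i` and high labels `hi i`. -/
theorem Labeled.alternating_even {p : ℕ} {lo hi : ℕ → ℤ} {A D : Set ℤ} (h0 : lo p = lo 0)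
    (hlt : ∀ i j, i ≤ p → j < p → lo i < hi j)
    (hlo : ∀ i j, i < p → j < p → lo i = lo j → i = j)
    (hhi : ∀ i j, i < p → j < p → hi i = hi j → i = j)
    (hup : ∀ i j, i < p → j < p → hi i - lo i = hi j - lo j → i = j)
    (hdn : ∀ i j, i < p → j < p → lo (i + 1) - hi i = lo (j + 1) - hi j → i = j)
    (hA : ∀ x, x ∈ A ↔ ∃ i < p, x = lo i ∨ x = hi i)
    (hD : ∀ i < p, hi i - lo i ∈ D ∧ lo (i + 1) - hi i ∈ D) : Labeled {2 * p} A D := by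
  have hg0 : alternate lo hi (2 * p) = alternate lo hi 0 := by
    rw [alternate_even, ← Nat.mul_zero 2, alternate_even, h0]
  refine ((Labeled.circuit (alternate lo hi) hg0 ?_ ?_).congr rfl fun x => ?_).mono ?_
  · intro v w hv hw h
    obtain ⟨i, rfl | rfl⟩ := Nat.even_or_odd' v <;> obtain ⟨j, rfl | rfl⟩ := Nat.even_or_odd' w <;>
      simp only [alternate_even, alternate_odd] at h
    · have := hlo i j (by omega) (by omega) h; omega
    · have := hlt i j (by omega) (by omega); omega
    · have := hlt j i (by omega) (by omega); omega
    · have := hhi i j (by omega) (by omega) h; omega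
  · intro v w hv hw h
    obtain ⟨i, rfl | rfl⟩ := Nat.even_or_odd' v <;> obtain ⟨j, rfl | rfl⟩ := Nat.even_or_odd' w <;>
      simp only [alternate_even, alternate_odd, alternate_odd_succ] at h
    -- Upward arcs have positive and downward arcs negative differences, so only arcs of the same
    -- direction can conflict.
    · have := hup i j (by omega) (by omega) h; omega
    · have := hlt i i (by omega) (by omega)
      have := hlt (j + 1) j (by omega) (by omega); omega
    · have := hlt j j (by omega) (by omega)
      have := hlt (i + 1) i (by omega) (by omega); omega
    · have := hdn i j (by omega) (by omega) h; omega
  · rw [hA]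
    constructor
    · rintro ⟨v, hv, rfl⟩
      obtain ⟨i, rfl | rfl⟩ := Nat.even_or_odd' v
      · exact ⟨i, by omega, Or.inl (alternate_even ..)⟩
      · exact ⟨i, by omega, Or.inr (alternate_odd ..)⟩
    · rintro ⟨i, hi, rfl | rfl⟩
      · exact ⟨2 * i, by omega, (alternate_even ..).symm⟩
      · exact ⟨2 * i + 1, by omega, (alternate_odd ..).symm⟩
  · rintro d ⟨v, hv, rfl⟩
    obtain ⟨i, rfl | rfl⟩ := Nat.even_or_odd' v
    · rw [alternate_even, alternate_odd]; exact (hD i (by omega)).1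
    · rw [alternate_odd_succ, alternate_odd]; exact (hD i (by omega)).2

/-- A circuit of odd length that alternates between low labels `lo i` and high labels `hi i`,
except for one arc between the low labels `lo q` and `lo 0`. -/
theorem Labeled.alternating_odd {q : ℕ} {lo hi : ℕ → ℤ} {A D : Set ℤ} (h0 : hi q = lo 0)
    (hlt : ∀ i j, i ≤ q → j < q → lo i < hi j)
    (hlo : ∀ i j, i ≤ q → j ≤ q → lo i = lo j → i = j)
    (hhi : ∀ i j, i < q → j < q → hi i = hi j → i = j)
    (hup : ∀ i j, i < q → j < q → hi i - lo i = hi j - lo j → i = j)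
    (hdn : ∀ i j, i < q → j < q → lo (i + 1) - hi i = lo (j + 1) - hi j → i = j)
    (hcl : ∀ i < q, hi i - lo i ≠ lo 0 - lo q ∧ lo (i + 1) - hi i ≠ lo 0 - lo q)
    (hA : ∀ x, x ∈ A ↔ x = lo q ∨ ∃ i < q, x = lo i ∨ x = hi i)
    (hD : ∀ i < q, hi i - lo i ∈ D ∧ lo (i + 1) - hi i ∈ D) (hDq : lo 0 - lo q ∈ D) :
    Labeled {2 * q + 1} A D := by
  -- Position `2 * q + 1` reads `hi q`, which is not a label of its own but the return to `lo 0`.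
  have hg0 : alternate lo hi (2 * q + 1) = alternate lo hi 0 := by
    rw [alternate_odd, ← Nat.mul_zero 2, alternate_even, h0]
  refine ((Labeled.circuit (alternate lo hi) hg0 ?_ ?_).congr rfl fun x => ?_).mono ?_
  · intro v w hv hw h
    obtain ⟨i, rfl | rfl⟩ := Nat.even_or_odd' v <;> obtain ⟨j, rfl | rfl⟩ := Nat.even_or_odd' w <;>
      simp only [alternate_even, alternate_odd] at h
    · have := hlo i j (by omega) (by omega) h; omega
    · have := hlt i j (by omega) (by omega); omega
    · have := hlt j i (by omega) (by omega); omega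
    · have := hhi i j (by omega) (by omega) h; omega
  · intro v w hv hw h
    obtain ⟨i, rfl | rfl⟩ := Nat.even_or_odd' v <;> obtain ⟨j, rfl | rfl⟩ := Nat.even_or_odd' w <;>
      simp only [alternate_even, alternate_odd, alternate_odd_succ] at h
    -- An even position with `i = q` is the exceptional arc from `lo q` to `lo 0`; `hcl` separates
    -- it from all others.
    · rcases (show i ≤ q by omega).lt_or_eq with hi' | hi' <;>
        rcases (show j ≤ q by omega).lt_or_eq with hj' | hj'
      · have := hup i j hi' hj' h; omega
      · exact ((hcl i hi').1 (by rw [h, hj', h0])).elim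
      · exact ((hcl j hj').1 (by rw [← h, hi', h0])).elim
      · rw [hi', hj']
    · rcases (show i ≤ q by omega).lt_or_eq with hi' | rfl
      · have := hlt i i (by omega) (by omega)
        have := hlt (j + 1) j (by omega) (by omega); omega
      · exact ((hcl j (by omega)).2 (by rw [← h, h0])).elim
    · rcases (show j ≤ q by omega).lt_or_eq with hj' | rfl
      · have := hlt j j (by omega) (by omega)
        have := hlt (i + 1) i (by omega) (by omega); omega
      · exact ((hcl i (by omega)).2 (by rw [h, h0])).elim
    · have := hdn i j (by omega) (by omega) h; omega
  · rw [hA]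
    constructor
    · rintro ⟨v, hv, rfl⟩
      obtain ⟨i, rfl | rfl⟩ := Nat.even_or_odd' v
      · rw [alternate_even]
        rcases (show i ≤ q by omega).lt_or_eq with hi' | rfl
        · exact Or.inr ⟨i, by omega, Or.inl rfl⟩
        · exact Or.inl rfl
      · exact Or.inr ⟨i, by omega, Or.inr (alternate_odd ..)⟩
    · rintro (rfl | ⟨i, hi, rfl | rfl⟩)
      · exact ⟨2 * q, by omega, (alternate_even ..).symm⟩
      · exact ⟨2 * i, by omega, (alternate_even ..).symm⟩
      · exact ⟨2 * i + 1, by omega, (alternate_odd ..).symm⟩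
  · rintro d ⟨v, hv, rfl⟩
    obtain ⟨i, rfl | rfl⟩ := Nat.even_or_odd' v
    · rw [alternate_even, alternate_odd]
      rcases (show i ≤ q by omega).lt_or_eq with hi' | rfl
      · exact (hD i hi').1
      · rw [h0]; exact hDq
    · rw [alternate_odd_succ, alternate_odd]; exact (hD i (by omega)).2

/-! ### Nesting, and even circuits around a gap -/

/-- Put a labelling with labels `1, …, n` inside one with low and high labels. -/
theorem Labeled.nest {s e : Multiset ℕ} {n l m : ℕ} {D D' : Set ℤ}
    (h : Labeled s (Set.Icc 1 n) D)
    (h' : Labeled e (Set.Icc 1 l ∪ Set.Icc (n + l + 1) (n + m)) D') (hlm : l ≤ m)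
    (hD : ∀ d ∈ D, 1 - (n : ℤ) ≤ d → d ≤ n - 1 → d ∉ D') :
    Labeled (s + e) (Set.Icc 1 ((n + m : ℕ) : ℤ)) Set.univ := by
  refine (((h.bounded.translate l).add h' ?_ ?_).congr rfl ?_).mono (Set.subset_univ _)
  · intro x
    simp only [Set.mem_ofPred_eq, Set.mem_Icc, Set.mem_union]
    omega
  · rintro d ⟨hd, h1, h2⟩
    exact hD d hd h1 h2
  · intro x
    simp only [Set.mem_ofPred_eq, Set.mem_Icc, Set.mem_union]
    omega

/-- Circuits of lengths `e` (of even sum) that can be labelled with equally many low and high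
labels, with a gap in between, such that all differences exceed those within the gap. -/
def Extendable (e : Multiset ℕ) : Prop :=
  ∃ p : ℕ, e.sum = 2 * p ∧ ∀ n : ℕ,
    Labeled e (Set.Icc 1 p ∪ Set.Icc (n + p + 1) (n + (2 * p : ℕ))) {d | (n : ℤ) ≤ |d|}

theorem Graceful.add {s e : Multiset ℕ} (h : Graceful s) (he : Extendable e) :
    Graceful (s + e) := by
  obtain ⟨p, hp, he⟩ := he
  unfold Graceful
  rw [Multiset.sum_add, hp]
  refine Labeled.nest h (he _) (by omega) ?_
  intro d _ h1 h2 h3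
  simp only [Set.mem_ofPred_eq, le_abs] at h3
  omega

/-- In the zigzag `1, n + 2p, 2, n + 2p - 1, …` all downward differences are congruent to `n` modulo
2, except the closing one, `-(n + p)`. It has the other parity because `p` is odd. -/
theorem extendable_of_odd {p : ℕ} (hp : p % 2 = 1) : Extendable {2 * p} := by
  refine ⟨p, by simp, fun n => ?_⟩
  refine Labeled.alternating_even (lo := fun i => if i < p then i + 1 else 1)
    (hi := fun i => n + 2 * p - i) ?_ ?_ ?_ ?_ ?_ ?_ ?_ ?_
  · split_ifs <;> omega
  · intro i j hi hj; split_ifs <;> omega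
  · intro i j hi hj; split_ifs; omega
  · intro i j hi hj; omega
  · intro i j hi hj; split_ifs; omega
  · intro i j hi hj; split_ifs <;> omega
  · intro x
    simp only [Set.mem_union, Set.mem_Icc]
    constructor
    · rintro (h | h)
      · exact ⟨(x - 1).toNat, by omega, by left; split_ifs <;> omega⟩
      · exact ⟨(n + 2 * p - x).toNat, by omega, by right; omega⟩
    · rintro ⟨i, hi, h | h⟩
      · split_ifs at h; omega
      · omega
  · intro i hi
    simp only [Set.mem_ofPred_eq, le_abs]
    split_ifs <;> omega

/-- For even `p` the closing difference of the plain zigzag would be repeated. Permuting the last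
three high labels cyclically turns it into `-(n + p + 1)`; the only other downward difference of
that parity is `-(n + 3)`, which is different as `p ≠ 2`. -/
theorem extendable_of_even {p : ℕ} (hp : p % 2 = 0) (h4 : 4 ≤ p) : Extendable {2 * p} := by
  refine ⟨p, by simp, fun n => ?_⟩
  refine Labeled.alternating_even (lo := fun i => if i < p then i + 1 else 1)
    (hi := fun i => n + 2 * p - (if i + 3 = p then p - 1 else if i + 3 < p then i else i - 1))
    ?_ ?_ ?_ ?_ ?_ ?_ ?_ ?_
  · split_ifs <;> omega
  · intro i j hi hj; split_ifs <;> omega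
  · intro i j hi hj; split_ifs; omega
  · intro i j hi hj; split_ifs <;> omega
  · intro i j hi hj; split_ifs <;> omega
  · intro i j hi hj; split_ifs <;> omega
  · intro x
    simp only [Set.mem_union, Set.mem_Icc]
    constructor
    · rintro (h | h)
      · exact ⟨(x - 1).toNat, by omega, by left; split_ifs <;> omega⟩
      · rcases lt_trichotomy (n + 2 * p - x) (p - 3) with h' | h' | h'
        · exact ⟨(n + 2 * p - x).toNat, by omega, by right; split_ifs <;> omega⟩
        · exact ⟨p - 2, by omega, by right; split_ifs <;> omega⟩
        · rcases eq_or_ne (n + 2 * p - x) (p - 1) with h'' | h''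
          · exact ⟨p - 3, by omega, by right; split_ifs <;> omega⟩
          · exact ⟨p - 1, by omega, by right; split_ifs <;> omega⟩
    · rintro ⟨i, hi, h | h⟩ <;> split_ifs at h <;> omega
  · intro i hi
    simp only [Set.mem_ofPred_eq, le_abs]
    split_ifs <;> omega

/-- A single 4-circuit is not extendable: both ways of alternating between two low and two high
labels repeat a difference. -/
theorem extendable_four_four : Extendable {4, 4} := by
  refine ⟨4, by simp, fun n => ⟨[[1, n + 8, 2, n + 6], [3, n + 5, 4, n + 7]], ?_, ?_, ?_, ?_, ?_⟩⟩
  · rfl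
  · simp; omega
  · intro x
    simp
    omega
  · simp [cycDiffs]; omega
  · intro d hd
    simp [cycDiffs] at hd
    simp only [Set.mem_ofPred_eq, le_abs]
    omega

/-! ### One odd circuit of length at least 5 -/

/-- A circuit of odd length, labelled around a gap of even length `g`. -/
theorem labeled_odd_of_even {q g : ℕ} (hq : q % 2 = 0) (hg : g % 2 = 0) (h2 : 2 ≤ q) :
    Labeled {2 * q + 1} (Set.Icc 1 ((q + 1 : ℕ) : ℤ) ∪
      Set.Icc (g + (q + 1 : ℕ) + 1) (g + (2 * q + 1 : ℕ))) {d | (q : ℤ) ≤ |d| ∨ (g : ℤ) < |d|} := by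
  -- The exceptional difference is `-q`, which is even, while all downward differences are odd since
  -- `g` is even.
  refine Labeled.alternating_odd (lo := fun i => i + 1)
    (hi := fun i => if i < q then g + 2 * q + 1 - i else 1) ?_ ?_ ?_ ?_ ?_ ?_ ?_ ?_ ?_ ?_
  · simp
  · intro i j hi hj; split_ifs; omega
  · intro i j hi hj; omega
  · intro i j hi hj; split_ifs; omega
  · intro i j hi hj; split_ifs; omega
  · intro i j hi hj; split_ifs; omega
  · intro i hi; split_ifs; omega
  · intro x
    simp only [Set.mem_union, Set.mem_Icc]
    constructor
    · rintro (h | h)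
      · rcases eq_or_ne x (q + 1) with h' | h'
        · left; omega
        · right
          exact ⟨(x - 1).toNat, by omega, by left; omega⟩
      · right
        exact ⟨(g + 2 * q + 1 - x).toNat, by omega, by right; split_ifs <;> omega⟩
    · rintro (h | ⟨i, hi, h | h⟩)
      · omega
      · omega
      · split_ifs at h; omega
  · intro i hi
    simp only [Set.mem_ofPred_eq, le_abs, lt_abs]
    split_ifs; omega
  · simp only [Set.mem_ofPred_eq, le_abs, lt_abs]
    omega

theorem labeled_odd_of_odd {q g : ℕ} (hq : q % 2 = 1) (hg : g % 2 = 0) (h2 : 3 ≤ q) :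
    Labeled {2 * q + 1} (Set.Icc 1 ((q + 1 : ℕ) : ℤ) ∪
      Set.Icc (g + (q + 1 : ℕ) + 1) (g + (2 * q + 1 : ℕ)))
      {d | (q : ℤ) - 1 ≤ |d| ∨ (g : ℤ) < |d|} := by
  -- The last two low labels are swapped, so the exceptional difference is `1 - q`, again even; the
  -- two smallest high labels are swapped too, which keeps the downward differences odd and
  -- distinct.
  refine Labeled.alternating_odd
    (lo := fun i => if i + 1 = q then q + 1 else if i = q then q else i + 1)
    (hi := fun i => if i + 2 = q then g + q + 2 else if i + 1 = q then g + q + 3 else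
      if i < q then g + 2 * q + 1 - i else 1) ?_ ?_ ?_ ?_ ?_ ?_ ?_ ?_ ?_ ?_
  · split_ifs <;> omega
  · intro i j hi hj; split_ifs <;> omega
  · intro i j hi hj; split_ifs <;> omega
  · intro i j hi hj; split_ifs <;> omega
  · intro i j hi hj; split_ifs <;> omega
  · intro i j hi hj; split_ifs <;> omega
  · intro i hi; split_ifs <;> omega
  · intro x
    simp only [Set.mem_union, Set.mem_Icc]
    constructor
    · rintro (h | h)
      · rcases lt_trichotomy x q with h' | h' | h'
        · right
          exact ⟨(x - 1).toNat, by omega, by left; split_ifs <;> omega⟩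
        · left; split_ifs <;> omega
        · right
          exact ⟨q - 1, by omega, by left; split_ifs <;> omega⟩
      · right
        rcases eq_or_ne x (g + q + 2) with h' | h'
        · exact ⟨q - 2, by omega, by right; split_ifs <;> omega⟩
        rcases eq_or_ne x (g + q + 3) with h' | h'
        · exact ⟨q - 1, by omega, by right; split_ifs <;> omega⟩
        · exact ⟨(g + 2 * q + 1 - x).toNat, by omega, by right; split_ifs <;> omega⟩
    · rintro (h | ⟨i, hi, h | h⟩)
      · split_ifs at h <;> omega
      · split_ifs at h <;> omega
      · split_ifs at h <;> omega
  · intro i hi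
    simp only [Set.mem_ofPred_eq, le_abs, lt_abs]
    split_ifs <;> omega
  · simp only [Set.mem_ofPred_eq, le_abs, lt_abs]
    split_ifs <;> omega

theorem graceful_zero : Graceful 0 :=
  graceful_of_list [] rfl (by decide) (by decide) (by decide)

theorem graceful_four : Graceful {4} :=
  graceful_of_list [[1, 2, 4, 3]] rfl (by decide) (by decide) (by decide)

theorem graceful_odd {q : ℕ} (h2 : 2 ≤ q) : Graceful {2 * q + 1} := by
  unfold Graceful
  rcases Nat.mod_two_eq_zero_or_one q with hq | hq
  · refine ((labeled_odd_of_even (g := 0) hq rfl h2).congr rfl fun x => ?_).mono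
      (Set.subset_univ _)
    simp only [Set.mem_union, Set.mem_Icc, Multiset.sum_singleton]
    omega
  · refine ((labeled_odd_of_odd (g := 0) hq rfl (by omega)).congr rfl fun x => ?_).mono
      (Set.subset_univ _)
    simp only [Set.mem_union, Set.mem_Icc, Multiset.sum_singleton]
    omega

theorem labeled_four : Labeled {4} (Set.Icc 1 (4 : ℕ)) {d | |d| ≤ 2} := by
  refine ⟨[[1, 2, 4, 3]], rfl, by decide, fun x => ?_, by decide, ?_⟩
  · simp; omega
  · intro d hd
    simp [cycDiffs] at hd
    simp only [Set.mem_ofPred_eq, abs_le]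
    omega

/-- The 4-circuit sits in a gap of size 4 with differences `±1, ±2`. The exceptional arc of the odd
circuit has absolute difference `q` or `q - 1`, which exceeds 2 when `q ≥ 4`; `q = 2, 3` need
separate tables. -/
theorem graceful_odd_four {q : ℕ} (h2 : 2 ≤ q) : Graceful ({2 * q + 1} + {4}) := by
  rcases (show q = 2 ∨ q = 3 ∨ 4 ≤ q by omega) with rfl | rfl | h4
  · exact graceful_of_list [[9, 3, 1, 8, 4], [7, 2, 6, 5]] rfl (by decide) (by decide) (by decide)
  · exact graceful_of_list [[10, 9, 5, 3, 7, 8, 2], [11, 4, 6, 1]] rfl (by decide) (by decide)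
      (by decide)
  have key : ∀ D', Labeled {2 * q + 1} (Set.Icc 1 ((q + 1 : ℕ) : ℤ) ∪
      Set.Icc ((4 : ℕ) + (q + 1 : ℕ) + 1) ((4 : ℕ) + (2 * q + 1 : ℕ))) D' →
      (∀ d ∈ D', 2 < |d|) → Graceful ({2 * q + 1} + {4}) := by
    intro D' h hD'
    unfold Graceful
    refine (labeled_four.nest h (by omega) ?_).congr (add_comm _ _) fun x => ?_
    · intro d hd _ _ hd'
      have := hD' d hd'
      simp only [Set.mem_ofPred_eq] at hd
      omega
    · simp only [Multiset.sum_add, Multiset.sum_singleton, Set.mem_Icc]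
      omega
  rcases Nat.mod_two_eq_zero_or_one q with hq | hq
  · refine key _ (labeled_odd_of_even hq rfl h2) ?_
    intro d hd
    simp only [Set.mem_ofPred_eq] at hd
    omega
  · refine key _ (labeled_odd_of_odd hq rfl (by omega)) ?_
    intro d hd
    simp only [Set.mem_ofPred_eq] at hd
    omega

/-! ### Families of triangles -/

theorem Labeled.triangle {a b c : ℤ} (h : a ≠ b ∧ b ≠ c ∧ a ≠ c)
    (hd : b - a ≠ c - b ∧ c - b ≠ a - c ∧ b - a ≠ a - c) :
    Labeled {3} {x | x = a ∨ x = b ∨ x = c} {d | d = b - a ∨ d = c - b ∨ d = a - c} := by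
  refine ⟨[[a, b, c]], rfl, ?_, fun x => ?_, ?_, ?_⟩
  · simp; tauto
  · simp
  · simp [cycDiffs]; tauto
  · simp [cycDiffs]

/-- A family of labelled triangles `x i → y i → z i → x i`. -/
theorem Labeled.triangles (u : ℕ) (x y z : ℕ → ℤ)
    (hl : ∀ i j, i < u → j < u → x i ≠ y j ∧ y i ≠ z j ∧ x i ≠ z j ∧
      (x i = x j → i = j) ∧ (y i = y j → i = j) ∧ (z i = z j → i = j))
    (hd : ∀ i j, i < u → j < u → y i - x i ≠ z j - y j ∧ z i - y i ≠ x j - z j ∧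
      y i - x i ≠ x j - z j ∧ (y i - x i = y j - x j → i = j) ∧
      (z i - y i = z j - y j → i = j) ∧ (x i - z i = x j - z j → i = j)) :
    Labeled (Multiset.replicate u 3) {a | ∃ i < u, a = x i ∨ a = y i ∨ a = z i}
      {d | ∃ i < u, d = y i - x i ∨ d = z i - y i ∨ d = x i - z i} := by
  induction u with
  | zero => exact (Labeled.zero _).congr rfl (by simp)
  | succ u ih =>
    have h1 := ih (fun i j hi hj => hl i j (by omega) (by omega))
      (fun i j hi hj => hd i j (by omega) (by omega))
    have hl' := hl u u (by omega) (by omega)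
    have hd' := hd u u (by omega) (by omega)
    have h2 := Labeled.triangle (a := x u) (b := y u) (c := z u)
      ⟨hl'.1, hl'.2.1, hl'.2.2.1⟩ ⟨hd'.1, hd'.2.1, hd'.2.2.1⟩
    refine ((h1.add h2 ?_ ?_).congr ?_ ?_).mono ?_
    · rintro a ⟨i, hi, h⟩ h'
      have h3 := hl i u (by omega) (by omega)
      have h4 := hl u i (by omega) (by omega)
      simp only [Set.mem_ofPred_eq] at h'
      omega
    · rintro a ⟨i, hi, h⟩ h'
      have h3 := hd i u (by omega) (by omega)
      have h4 := hd u i (by omega) (by omega)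
      simp only [Set.mem_ofPred_eq] at h'
      omega
    · rw [Multiset.replicate_succ, ← Multiset.singleton_add, add_comm]
    · intro a
      simp only [Set.mem_union, Set.mem_ofPred_eq, Nat.lt_succ_iff_lt_or_eq, or_and_right,
        exists_or, exists_eq_left]
    · intro a
      simp only [Set.mem_union, Set.mem_ofPred_eq, Nat.lt_succ_iff_lt_or_eq, or_and_right,
        exists_or, exists_eq_left]
      exact id

/-- Each side of each of the four families gives an arithmetic progression of differences. The
progressions occupy disjoint ranges, except `3u - 2 - 2i` and `u + 1 + 2i`, which interleave by
parity. -/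
theorem labeled_triangles_four_mul (u : ℕ) :
    Labeled (Multiset.replicate (4 * u) 3) (Set.Icc 1 ((12 * u : ℕ) : ℤ)) {d | (u : ℤ) ≤ |d|} := by
  have h1 := Labeled.triangles u (fun i => 1 + 2 * i) (fun i => 4 * u + 3 + 3 * i)
    (fun i => 7 * u + 1 + i) (by intro i j hi hj; omega) (by intro i j hi hj; omega)
  have h2 := Labeled.triangles u (fun i => 2 + 2 * i) (fun i => 11 * u - i)
    (fun i => 2 * u + 1 + i) (by intro i j hi hj; omega) (by intro i j hi hj; omega)
  have h3 := Labeled.triangles u (fun i => 3 * u + 1 + i) (fun i => 4 * u + 2 + 3 * i)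
    (fun i => 8 * u + 2 + 2 * i) (by intro i j hi hj; omega) (by intro i j hi hj; omega)
  have h4 := Labeled.triangles u (fun i => 4 * u + 1 + 3 * i) (fun i => 11 * u + 1 + i)
    (fun i => 8 * u + 1 + 2 * i) (by intro i j hi hj; omega) (by intro i j hi hj; omega)
  refine ((((h1.add h2 ?_ ?_).add h3 ?_ ?_).add h4 ?_ ?_).congr ?_ ?_).mono ?_
  · rintro a ⟨i, hi, h⟩ ⟨j, hj, h'⟩; omega
  · rintro a ⟨i, hi, h⟩ ⟨j, hj, h'⟩; omega
  · rintro a (⟨i, hi, h⟩ | ⟨i, hi, h⟩) ⟨j, hj, h'⟩ <;> omega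
  · rintro a (⟨i, hi, h⟩ | ⟨i, hi, h⟩) ⟨j, hj, h'⟩ <;> omega
  · rintro a ((⟨i, hi, h⟩ | ⟨i, hi, h⟩) | ⟨i, hi, h⟩) ⟨j, hj, h'⟩ <;> omega
  · rintro a ((⟨i, hi, h⟩ | ⟨i, hi, h⟩) | ⟨i, hi, h⟩) ⟨j, hj, h'⟩ <;> omega
  · rw [← Multiset.replicate_add, ← Multiset.replicate_add, ← Multiset.replicate_add]
    congr 1; ring
  · intro a
    constructor
    · rintro (((⟨i, hi, h⟩ | ⟨i, hi, h⟩) | ⟨i, hi, h⟩) | ⟨i, hi, h⟩) <;>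
        simp only [Set.mem_Icc] <;> omega
    · intro h
      simp only [Set.mem_Icc] at h
      simp only [Set.mem_union, Set.mem_ofPred_eq]
      -- The blocks `[1, 2u]` and `(8u, 10u]` are shared by two families according to parity, `(4u,
      -- 7u]` by three according to residue modulo 3; every other block belongs to one family.
      rcases (show a ≤ 2 * u ∨ (2 * u < a ∧ a ≤ 3 * u) ∨ (3 * u < a ∧ a ≤ 4 * u) ∨
        (4 * u < a ∧ a ≤ 7 * u) ∨ (7 * u < a ∧ a ≤ 8 * u) ∨ (8 * u < a ∧ a ≤ 10 * u) ∨
        (10 * u < a ∧ a ≤ 11 * u) ∨ 11 * u < a by omega) with h | h | h | h | h | h | h | h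
      · rcases Int.emod_two_eq_zero_or_one a with h' | h'
        · exact Or.inl (Or.inl (Or.inr ⟨((a - 2) / 2).toNat, by omega, by omega⟩))
        · exact Or.inl (Or.inl (Or.inl ⟨((a - 1) / 2).toNat, by omega, by omega⟩))
      · exact Or.inl (Or.inl (Or.inr ⟨(a - 2 * u - 1).toNat, by omega, by omega⟩))
      · exact Or.inl (Or.inr ⟨(a - 3 * u - 1).toNat, by omega, by omega⟩)
      · rcases (show (a - 4 * u) % 3 = 0 ∨ (a - 4 * u) % 3 = 1 ∨ (a - 4 * u) % 3 = 2 by omega)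
          with h' | h' | h'
        · exact Or.inl (Or.inl (Or.inl ⟨((a - 4 * u - 3) / 3).toNat, by omega, by omega⟩))
        · exact Or.inr ⟨((a - 4 * u - 1) / 3).toNat, by omega, by omega⟩
        · exact Or.inl (Or.inr ⟨((a - 4 * u - 2) / 3).toNat, by omega, by omega⟩)
      · exact Or.inl (Or.inl (Or.inl ⟨(a - 7 * u - 1).toNat, by omega, by omega⟩))
      · rcases Int.emod_two_eq_zero_or_one a with h' | h'
        · exact Or.inl (Or.inr ⟨((a - 8 * u - 2) / 2).toNat, by omega, by omega⟩)
        · exact Or.inr ⟨((a - 8 * u - 1) / 2).toNat, by omega, by omega⟩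
      · exact Or.inl (Or.inl (Or.inr ⟨(11 * u - a).toNat, by omega, by omega⟩))
      · exact Or.inr ⟨(a - 11 * u - 1).toNat, by omega, by omega⟩
  · rintro d (((⟨i, hi, h⟩ | ⟨i, hi, h⟩) | ⟨i, hi, h⟩) | ⟨i, hi, h⟩) <;>
      simp only [Set.mem_ofPred_eq, le_abs] <;> omega

/-! ### One triangle with one even circuit -/

/-- The triangle takes the differences `1, 2, -3`. The zigzag on the remaining labels has odd
downward differences, at most `-5`, except the closing `-(p + 2)`, which is even; its last upward
difference is the free value `3`. -/
theorem graceful_three_even_of_even {p : ℕ} (hp : p % 2 = 0) (h2 : 2 ≤ p) :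
    Graceful ({3} + {2 * p}) := by
  have h1 := Labeled.triangle (a := p + 1) (b := p + 2) (c := p + 4) (by omega) (by omega)
  have h2 : Labeled {2 * p} {x | 1 ≤ x ∧ x ≤ 2 * p + 3 ∧ x ≠ p + 1 ∧ x ≠ p + 2 ∧ x ≠ p + 4}
      {d | 3 ≤ d ∨ d < -3} := by
    refine Labeled.alternating_even (lo := fun i => if i < p then i + 1 else 1)
      (hi := fun i => if i + 1 < p then 2 * p + 3 - i else p + 3) ?_ ?_ ?_ ?_ ?_ ?_ ?_ ?_
    · split_ifs <;> omega
    · intro i j hi hj; split_ifs <;> omega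
    · intro i j hi hj; split_ifs; omega
    · intro i j hi hj; split_ifs <;> omega
    · intro i j hi hj; split_ifs <;> omega
    · intro i j hi hj; split_ifs <;> omega
    · intro x
      simp only [Set.mem_ofPred_eq]
      constructor
      · intro h
        rcases (show x ≤ p ∨ x = p + 3 ∨ p + 5 ≤ x by omega) with h' | h' | h'
        · exact ⟨(x - 1).toNat, by omega, by left; split_ifs <;> omega⟩
        · exact ⟨p - 1, by omega, by right; split_ifs <;> omega⟩
        · exact ⟨(2 * p + 3 - x).toNat, by omega, by right; split_ifs <;> omega⟩
      · rintro ⟨i, hi, h | h⟩ <;> split_ifs at h <;> omega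
    · intro i hi
      simp only [Set.mem_ofPred_eq]
      split_ifs <;> omega
  refine ((h1.add h2 ?_ ?_).congr rfl ?_).mono (Set.subset_univ _) <;> intro x <;>
    simp only [Set.mem_ofPred_eq, Set.mem_union, Set.mem_Icc, Multiset.sum_add,
      Multiset.sum_singleton] <;> omega

/-- The same three labels are traversed backwards, giving `3, -2, -1` and freeing `-3` for the even
circuit. Its last three high labels are arranged so that the closing difference is `-(p + 5)`. -/
theorem graceful_three_even_of_odd {p : ℕ} (hp : p % 2 = 1) (h2 : 3 ≤ p) :
    Graceful ({3} + {2 * p}) := by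
  have h1 := Labeled.triangle (a := p + 1) (b := p + 4) (c := p + 2) (by omega) (by omega)
  have h2 : Labeled {2 * p} {x | 1 ≤ x ∧ x ≤ 2 * p + 3 ∧ x ≠ p + 1 ∧ x ≠ p + 2 ∧ x ≠ p + 4}
      {d | 3 < d ∨ d ≤ -3} := by
    refine Labeled.alternating_even (lo := fun i => if i < p then i + 1 else 1)
      (hi := fun i => if i + 3 < p then 2 * p + 3 - i else if i + 3 = p then p + 5 else
        if i + 2 = p then p + 3 else p + 6) ?_ ?_ ?_ ?_ ?_ ?_ ?_ ?_
    · split_ifs <;> omega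
    · intro i j hi hj; split_ifs <;> omega
    · intro i j hi hj; split_ifs; omega
    · intro i j hi hj; split_ifs <;> omega
    · intro i j hi hj; split_ifs <;> omega
    · intro i j hi hj; split_ifs <;> omega
    · intro x
      simp only [Set.mem_ofPred_eq]
      constructor
      · intro h
        rcases (show x ≤ p ∨ x = p + 3 ∨ x = p + 5 ∨ x = p + 6 ∨ p + 7 ≤ x by omega)
          with h' | h' | h' | h' | h'
        · exact ⟨(x - 1).toNat, by omega, by left; split_ifs <;> omega⟩
        · exact ⟨p - 2, by omega, by right; split_ifs <;> omega⟩
        · exact ⟨p - 3, by omega, by right; split_ifs <;> omega⟩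
        · exact ⟨p - 1, by omega, by right; split_ifs <;> omega⟩
        · exact ⟨(2 * p + 3 - x).toNat, by omega, by right; split_ifs <;> omega⟩
      · rintro ⟨i, hi, h | h⟩ <;> split_ifs at h <;> omega
    · intro i hi
      simp only [Set.mem_ofPred_eq]
      split_ifs <;> omega
  refine ((h1.add h2 ?_ ?_).congr rfl ?_).mono (Set.subset_univ _) <;> intro x <;>
    simp only [Set.mem_ofPred_eq, Set.mem_union, Set.mem_Icc, Multiset.sum_add,
      Multiset.sum_singleton] <;> omega

theorem graceful_three_even {p : ℕ} (h2 : 2 ≤ p) : Graceful ({3} + {2 * p}) := by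
  rcases Nat.mod_two_eq_zero_or_one p with hp | hp
  · exact graceful_three_even_of_even hp h2
  · exact graceful_three_even_of_odd hp (by omega)

/-! ### Two or more triangles -/

theorem graceful_triangles_of_lt {t : ℕ} (h2 : 2 ≤ t) (ht : t < 12) :
    Graceful (Multiset.replicate t 3) := by
  interval_cases t
  · exact graceful_of_list
      [[6, 2, 3], [5, 4, 1]]
      (by decide) (by decide +kernel) (by decide +kernel) (by decide +kernel)
  · exact graceful_of_list
      [[9, 8, 2], [7, 5, 1], [6, 3, 4]]
      (by decide) (by decide +kernel) (by decide +kernel) (by decide +kernel)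
  · exact graceful_of_list
      [[12, 9, 8], [11, 5, 6], [10, 3, 1], [7, 2, 4]]
      (by decide) (by decide +kernel) (by decide +kernel) (by decide +kernel)
  · exact graceful_of_list
      [[15, 11, 10], [14, 4, 5], [13, 8, 6], [12, 9, 2], [7, 1, 3]]
      (by decide) (by decide +kernel) (by decide +kernel) (by decide +kernel)
  · exact graceful_of_list
      [[18, 6, 2], [17, 10, 11], [16, 1, 9], [15, 13, 5], [14, 3, 12], [8, 7, 4]]
      (by decide) (by decide +kernel) (by decide +kernel) (by decide +kernel)
  · exact graceful_of_list
      [[21, 15, 3], [20, 7, 16], [19, 17, 12], [18, 14, 4], [13, 5, 10], [11, 2, 1], [9, 6, 8]]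
      (by decide) (by decide +kernel) (by decide +kernel) (by decide +kernel)
  · exact graceful_of_list
      [[24, 7, 20], [23, 16, 4], [22, 11, 19], [21, 15, 1], [18, 5, 3], [17, 2, 12], [14, 9, 8],
      [13, 10, 6]]
      (by decide) (by decide +kernel) (by decide +kernel) (by decide +kernel)
  · exact graceful_of_list
      [[27, 26, 5], [25, 10, 24], [23, 18, 6], [22, 19, 17], [21, 12, 1], [20, 14, 7], [16, 8, 4],
      [15, 2, 9], [13, 3, 11]]
      (by decide) (by decide +kernel) (by decide +kernel) (by decide +kernel)
  · exact graceful_of_list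
      [[30, 7, 20], [29, 2, 17], [28, 11, 3], [27, 9, 13], [26, 1, 25], [24, 21, 6], [23, 22, 18],
      [19, 5, 16], [15, 10, 8], [14, 4, 12]]
      (by decide) (by decide +kernel) (by decide +kernel) (by decide +kernel)
  · exact graceful_of_list
      [[33, 28, 26], [32, 18, 21], [31, 4, 19], [30, 10, 3], [29, 17, 11], [27, 8, 5], [25, 14,
      23], [24, 2, 1], [22, 13, 9], [20, 7, 15], [16, 6, 12]]
      (by decide) (by decide +kernel) (by decide +kernel) (by decide +kernel)

theorem graceful_triangles_four_of_lt {t : ℕ} (h2 : 2 ≤ t) (ht : t < 12) :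
    Graceful (Multiset.replicate t 3 + {4}) := by
  interval_cases t
  · exact graceful_of_list
      [[10, 6, 9], [7, 1, 3], [8, 5, 4, 2]]
      (by decide) (by decide +kernel) (by decide +kernel) (by decide +kernel)
  · exact graceful_of_list
      [[13, 12, 8], [11, 9, 1], [6, 3, 5], [10, 4, 7, 2]]
      (by decide) (by decide +kernel) (by decide +kernel) (by decide +kernel)
  · exact graceful_of_list
      [[15, 6, 13], [14, 3, 4], [12, 8, 1], [10, 9, 7], [16, 11, 5, 2]]
      (by decide) (by decide +kernel) (by decide +kernel) (by decide +kernel)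
  · exact graceful_of_list
      [[19, 9, 8], [18, 15, 3], [17, 10, 12], [14, 1, 7], [13, 4, 5], [16, 2, 11, 6]]
      (by decide) (by decide +kernel) (by decide +kernel) (by decide +kernel)
  · exact graceful_of_list
      [[22, 13, 9], [21, 7, 5], [20, 14, 6], [18, 2, 8], [15, 3, 10], [12, 11, 1], [19, 4, 16,
      17]]
      (by decide) (by decide +kernel) (by decide +kernel) (by decide +kernel)
  · exact graceful_of_list
      [[24, 13, 16], [23, 7, 22], [21, 17, 2], [20, 12, 9], [15, 1, 6], [14, 4, 8], [10, 5, 3],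
      [25, 19, 18, 11]]
      (by decide) (by decide +kernel) (by decide +kernel) (by decide +kernel)
  · exact graceful_of_list
      [[28, 10, 18], [26, 20, 25], [24, 17, 8], [23, 1, 4], [22, 2, 11], [21, 13, 9], [19, 6, 12],
      [16, 14, 3], [27, 15, 5, 7]]
      (by decide) (by decide +kernel) (by decide +kernel) (by decide +kernel)
  · exact graceful_of_list
      [[29, 23, 21], [28, 12, 24], [26, 25, 13], [22, 5, 15], [20, 1, 6], [19, 9, 4], [18, 11, 2],
      [17, 3, 14], [16, 8, 10], [31, 27, 7, 30]]
      (by decide) (by decide +kernel) (by decide +kernel) (by decide +kernel)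
  · exact graceful_of_list
      [[34, 9, 32], [33, 19, 24], [30, 4, 22], [29, 17, 13], [28, 7, 21], [27, 25, 15], [26, 10,
      2], [23, 14, 8], [18, 11, 12], [16, 3, 6], [31, 20, 1, 5]]
      (by decide) (by decide +kernel) (by decide +kernel) (by decide +kernel)
  · exact graceful_of_list
      [[36, 14, 3], [35, 10, 4], [34, 13, 32], [33, 1, 11], [31, 8, 7], [30, 15, 29], [28, 18,
      16], [27, 20, 2], [25, 5, 12], [24, 19, 6], [23, 9, 17], [37, 21, 26, 22]]
      (by decide) (by decide +kernel) (by decide +kernel) (by decide +kernel)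

/-- In this and the following wrappings, arcs between the two sides have absolute difference at
least `n`, and arcs within one side use only `±1, ±2`. An odd circuit always has an arc of the
latter kind, so pure nesting is not enough for triangles. -/
theorem labeled_four_around {n : ℕ} (hn : 3 ≤ n) :
    Labeled ({4}) (Set.Icc 1 (2 : ℕ) ∪ Set.Icc (n + (2 : ℕ) + 1) (n + (4 : ℕ)))
      {d | |d| ≤ 2 ∨ (n : ℤ) ≤ |d|} := by
  refine ⟨[[n + 4, n + 3, 1, 2]], rfl, ?_, ?_, ?_, ?_⟩
  · simp; omega
  · intro x
    simp
    omega
  · simp [cycDiffs]; omega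
  · intro d hd
    simp [cycDiffs] at hd
    simp only [Set.mem_ofPred_eq, le_abs, abs_le]
    omega

theorem labeled_one_triangle_around {n : ℕ} (hn : 3 ≤ n) :
    Labeled (Multiset.replicate 1 3) (Set.Icc 1 (1 : ℕ) ∪ Set.Icc (n + (1 : ℕ) + 1) (n + (3 : ℕ)))
      {d | |d| ≤ 2 ∨ (n : ℤ) ≤ |d|} := by
  refine ⟨[[n + 3, 1, n + 2]], rfl, ?_, ?_, ?_, ?_⟩
  · simp; omega
  · intro x
    simp
    omega
  · simp [cycDiffs]; omega
  · intro d hd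
    simp [cycDiffs] at hd
    simp only [Set.mem_ofPred_eq, le_abs, abs_le]
    omega

theorem labeled_one_triangle_four_around {n : ℕ} (hn : 3 ≤ n) :
    Labeled (Multiset.replicate 1 3 + {4}) (Set.Icc 1 (3 : ℕ) ∪ Set.Icc (n + (3 : ℕ) + 1) (n + (7 : ℕ)))
      {d | |d| ≤ 2 ∨ (n : ℤ) ≤ |d|} := by
  refine ⟨[[n + 7, n + 6, 2], [n + 5, 3, 1, n + 4]], rfl, ?_, ?_, ?_, ?_⟩
  · simp; omega
  · intro x
    simp
    omega
  · simp [cycDiffs]; omega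
  · intro d hd
    simp [cycDiffs] at hd
    simp only [Set.mem_ofPred_eq, le_abs, abs_le]
    omega

theorem labeled_two_triangles_around {n : ℕ} (hn : 3 ≤ n) :
    Labeled (Multiset.replicate 2 3) (Set.Icc 1 (3 : ℕ) ∪ Set.Icc (n + (3 : ℕ) + 1) (n + (6 : ℕ)))
      {d | |d| ≤ 2 ∨ (n : ℤ) ≤ |d|} := by
  refine ⟨[[n + 6, 1, 2], [n + 5, n + 4, 3]], rfl, ?_, ?_, ?_, ?_⟩
  · simp; omega
  · intro x
    simp
    omega
  · simp [cycDiffs]; omega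
  · intro d hd
    simp [cycDiffs] at hd
    simp only [Set.mem_ofPred_eq, le_abs, abs_le]
    omega

theorem labeled_two_triangles_four_around {n : ℕ} (hn : 3 ≤ n) :
    Labeled (Multiset.replicate 2 3 + {4}) (Set.Icc 1 (5 : ℕ) ∪ Set.Icc (n + (5 : ℕ) + 1) (n + (10 : ℕ)))
      {d | |d| ≤ 2 ∨ (n : ℤ) ≤ |d|} := by
  refine ⟨[[n + 10, 3, 1], [n + 9, 4, n + 7], [n + 8, 5, n + 6, 2]], rfl, ?_, ?_, ?_, ?_⟩
  · simp; omega
  · intro x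
    simp
    omega
  · simp [cycDiffs]; omega
  · intro d hd
    simp [cycDiffs] at hd
    simp only [Set.mem_ofPred_eq, le_abs, abs_le]
    omega

theorem labeled_three_triangles_around {n : ℕ} (hn : 3 ≤ n) :
    Labeled (Multiset.replicate 3 3) (Set.Icc 1 (4 : ℕ) ∪ Set.Icc (n + (4 : ℕ) + 1) (n + (9 : ℕ)))
      {d | |d| ≤ 2 ∨ (n : ℤ) ≤ |d|} := by
  refine ⟨[[n + 9, n + 8, 1], [n + 7, 4, n + 5], [n + 6, 2, 3]], rfl, ?_, ?_, ?_, ?_⟩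
  · simp; omega
  · intro x
    simp
    omega
  · simp [cycDiffs]; omega
  · intro d hd
    simp [cycDiffs] at hd
    simp only [Set.mem_ofPred_eq, le_abs, abs_le]
    omega

theorem labeled_three_triangles_four_around {n : ℕ} (hn : 3 ≤ n) :
    Labeled (Multiset.replicate 3 3 + {4}) (Set.Icc 1 (6 : ℕ) ∪ Set.Icc (n + (6 : ℕ) + 1) (n + (13 : ℕ)))
      {d | |d| ≤ 2 ∨ (n : ℤ) ≤ |d|} := by
  refine ⟨[[n + 12, 1, n + 10], [n + 9, 2, n + 8], [n + 7, 5, 4], [n + 13, 3, n + 11, 6]], rfl, ?_, ?_, ?_, ?_⟩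
  · simp; omega
  · intro x
    simp
    omega
  · simp [cycDiffs]; omega
  · intro d hd
    simp [cycDiffs] at hd
    simp only [Set.mem_ofPred_eq, le_abs, abs_le]
    omega

/-- The differences of the block lie between `u ≥ 3` and `12 * u - 1` in absolute value, hence avoid
both ranges allowed to `e`. -/
theorem Labeled.graceful_around {u l m : ℕ} {e : Multiset ℕ} (hu : 3 ≤ u) (hlm : l ≤ m)
    (hm : e.sum = m)
    (he : Labeled e (Set.Icc 1 (l : ℤ) ∪
      Set.Icc (((12 * u : ℕ) : ℤ) + l + 1) (((12 * u : ℕ) : ℤ) + m))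
      {d | |d| ≤ 2 ∨ ((12 * u : ℕ) : ℤ) ≤ |d|}) :
    Graceful (Multiset.replicate (4 * u) 3 + e) := by
  refine ((labeled_triangles_four_mul u).nest he hlm ?_).congr rfl fun x => ?_
  · intro d hd h1 h2 h3
    simp only [Set.mem_ofPred_eq] at hd h3
    have : |d| ≤ ((12 * u : ℕ) : ℤ) - 1 := abs_le.2 ⟨by omega, by omega⟩
    omega
  · simp only [Multiset.sum_add, Multiset.sum_replicate, hm, smul_eq_mul, Set.mem_Icc]
    omega

theorem graceful_triangles {t : ℕ} (h2 : 2 ≤ t) : Graceful (Multiset.replicate t 3) := by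
  rcases Nat.lt_or_ge t 12 with ht | ht
  · exact graceful_triangles_of_lt h2 ht
  obtain ⟨u, r, hr, rfl⟩ : ∃ u r, r < 4 ∧ t = 4 * u + r :=
    ⟨t / 4, t % 4, by omega, by omega⟩
  have hu : 3 ≤ u := by omega
  have hn : 3 ≤ 12 * u := by omega
  rw [Multiset.replicate_add]
  interval_cases r
  · exact (labeled_triangles_four_mul u).mono (Set.subset_univ _) |>.congr (by simp) fun x => by
      simp only [Set.mem_Icc, Multiset.sum_add, Multiset.sum_replicate, smul_eq_mul]; omega
  · exact (labeled_one_triangle_around hn).graceful_around hu (by omega) (by simp)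
  · exact (labeled_two_triangles_around hn).graceful_around hu (by omega) (by simp)
  · exact (labeled_three_triangles_around hn).graceful_around hu (by omega) (by simp)

theorem graceful_triangles_four {t : ℕ} (h2 : 2 ≤ t) :
    Graceful (Multiset.replicate t 3 + {4}) := by
  rcases Nat.lt_or_ge t 12 with ht | ht
  · exact graceful_triangles_four_of_lt h2 ht
  obtain ⟨u, r, hr, rfl⟩ : ∃ u r, r < 4 ∧ t = 4 * u + r :=
    ⟨t / 4, t % 4, by omega, by omega⟩
  have hu : 3 ≤ u := by omega
  have hn : 3 ≤ 12 * u := by omega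
  rw [Multiset.replicate_add, add_assoc]
  interval_cases r
  · rw [Multiset.replicate_zero, zero_add]
    exact (labeled_four_around hn).graceful_around hu (by omega) (by simp)
  · exact (labeled_one_triangle_four_around hn).graceful_around hu (by omega) (by simp)
  · exact (labeled_two_triangles_four_around hn).graceful_around hu (by omega) (by simp)
  · exact (labeled_three_triangles_four_around hn).graceful_around hu (by omega) (by simp)

/-! ### Adding even circuits to the bases -/

theorem extendable_of_even_of_ne_four {x : ℕ} (hx : Even x) (h2 : 2 ≤ x) (h4 : x ≠ 4) :
    Extendable {x} := by
  obtain ⟨p, rfl⟩ := hx.exists_two_nsmul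
  rw [smul_eq_mul] at *
  rcases Nat.mod_two_eq_zero_or_one p with hp | hp
  · exact extendable_of_even hp (by omega)
  · exact extendable_of_odd hp

theorem Graceful.add_even {s E : Multiset ℕ} (hs : Graceful s)
    (hE : ∀ x ∈ E, Even x ∧ 2 ≤ x ∧ x ≠ 4) : Graceful (s + E) := by
  induction E using Multiset.induction with
  | empty => simpa using hs
  | cons a E ih =>
    obtain ⟨h1, h2, h3⟩ := hE a (by simp)
    have h := (ih fun x hx => hE x (by simp [hx])).add (extendable_of_even_of_ne_four h1 h2 h3)
    rwa [add_assoc, add_comm E, Multiset.singleton_add] at h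

theorem Graceful.add_replicate_four {s : Multiset ℕ} (hs : Graceful s) (c : ℕ) :
    Graceful (s + Multiset.replicate (2 * c) 4) := by
  induction c with
  | zero => simpa using hs
  | succ c ih =>
    have h := ih.add extendable_four_four
    rwa [add_assoc, show ({4, 4} : Multiset ℕ) = Multiset.replicate 2 4 from rfl,
      ← Multiset.replicate_add] at h

theorem eq_filter_add_replicate (E : Multiset ℕ) :
    E = E.filter (· ≠ 4) + Multiset.replicate (E.count 4) 4 := by
  conv_lhs => rw [← Multiset.filter_add_not (· ≠ 4) E]
  simp only [ne_eq, not_not, Multiset.filter_eq']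

/-- Circuits of length 4 are added in pairs; if their number is odd, the leftover one is absorbed in
the base `s + {4}`. -/
theorem Graceful.add_all_even {s E : Multiset ℕ} (hs : Graceful s) (hs4 : Graceful (s + {4}))
    (hE : ∀ x ∈ E, Even x ∧ 2 ≤ x) : Graceful (s + E) := by
  have hE' : ∀ x ∈ E.filter (· ≠ 4), Even x ∧ 2 ≤ x ∧ x ≠ 4 := by
    intro x hx
    rw [Multiset.mem_filter] at hx
    exact ⟨(hE x hx.1).1, (hE x hx.1).2, hx.2⟩
  rw [eq_filter_add_replicate E]
  obtain ⟨c, hc | hc⟩ := Nat.even_or_odd' (E.count 4)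
  · rw [hc, add_left_comm, add_comm]
    exact (hs.add_replicate_four c).add_even hE'
  · rw [hc, add_left_comm, add_comm, add_comm (2 * c), Multiset.replicate_add,
      Multiset.replicate_one, ← add_assoc s]
    exact (hs4.add_replicate_four c).add_even hE'

theorem graceful_three_four_four : Graceful ({3} + {4, 4}) :=
  graceful_of_list [[8, 4, 1], [11, 10, 5, 3], [9, 2, 6, 7]] rfl (by decide) (by decide)
    (by decide)

theorem graceful_three_two_two : Graceful ({3} + {2, 2}) :=
  graceful_of_list [[7, 2, 6], [5, 3], [4, 1]] rfl (by decide) (by decide) (by decide)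

/-- The base is chosen by what `E` offers: a 4-circuit if there is one, otherwise a circuit longer
than 2, otherwise two 2-circuits. -/
theorem graceful_three_add_even {E : Multiset ℕ} (hE : ∀ x ∈ E, Even x ∧ 2 ≤ x)
    (h0 : E ≠ 0) (h2 : E ≠ {2}) : Graceful ({3} + E) := by
  have h34 : Graceful ({3} + {4}) := graceful_three_even (p := 2) le_rfl
  by_cases h4 : 4 ∈ E
  · obtain ⟨E, rfl⟩ := Multiset.exists_cons_of_mem h4
    rw [← Multiset.singleton_add, ← add_assoc]
    refine h34.add_all_even ?_ fun x hx => hE x (by simp [hx])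
    rw [add_assoc]
    exact graceful_three_four_four
  by_cases h6 : ∃ x ∈ E, x ≠ 2
  · obtain ⟨x, hx, hx2⟩ := h6
    obtain ⟨hev, hle⟩ := hE x hx
    obtain ⟨p, rfl⟩ := hev.exists_two_nsmul
    obtain ⟨E, rfl⟩ := Multiset.exists_cons_of_mem hx
    rw [← Multiset.singleton_add, ← add_assoc]
    refine (graceful_three_even (p := p) (by rw [smul_eq_mul] at *; omega)).add_even fun x hx => ?_
    obtain ⟨h1, h2⟩ := hE x (by simp [hx])
    exact ⟨h1, h2, by rintro rfl; exact h4 (by simp [hx])⟩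
  · push Not at h6
    have hE2 := Multiset.eq_replicate_of_mem h6
    obtain ⟨a, ha⟩ : ∃ a, E.card = 2 + a := by
      refine ⟨E.card - 2, ?_⟩
      have h1 : E.card ≠ 0 := by simpa using h0
      have h3 : E.card ≠ 1 := by
        intro h
        rw [h] at hE2
        exact h2 hE2
      omega
    rw [hE2, ha, Multiset.replicate_add, ← add_assoc]
    refine (graceful_three_two_two : Graceful ({3} + Multiset.replicate 2 2)).add_even ?_
    intro x hx
    obtain rfl := Multiset.eq_of_mem_replicate hx
    decide

theorem graceful_of_multiset {s : Multiset ℕ} (h2 : ∀ x ∈ s, 2 ≤ x)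
    (hodd : (s.filter Odd).card ≤ 1 ∨ ∀ x ∈ s, Odd x → x = 3) (h3 : s ≠ {3}) (h23 : s ≠ {2, 3}) :
    Graceful s := by
  have hs : s = s.filter Odd + s.filter (fun x => ¬ Odd x) := (Multiset.filter_add_not _ _).symm
  have hE : ∀ x ∈ s.filter (fun x => ¬ Odd x), Even x ∧ 2 ≤ x := by
    intro x hx
    rw [Multiset.mem_filter] at hx
    exact ⟨Nat.not_odd_iff_even.1 hx.2, h2 x hx.1⟩
  generalize s.filter (fun x => ¬ Odd x) = E at hs hE
  -- Both alternatives of `hodd` reduce to these shapes; `t = 0` and `t = 1` are included in the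
  -- first.
  have key : (∃ t, s.filter Odd = Multiset.replicate t 3) ∨
      ∃ q, 2 ≤ q ∧ s.filter Odd = {2 * q + 1} := by
    rcases hodd with h | h
    · rcases Nat.le_one_iff_eq_zero_or_eq_one.1 h with h | h
      · exact Or.inl ⟨0, by simpa using h⟩
      · obtain ⟨a, ha⟩ := Multiset.card_eq_one.1 h
        have ha' : a ∈ s.filter Odd := by simp [ha]
        rw [Multiset.mem_filter] at ha'
        have h2a := h2 a ha'.1
        obtain ⟨q, rfl⟩ := ha'.2
        rcases (show q = 1 ∨ 2 ≤ q by omega) with rfl | hq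
        · exact Or.inl ⟨1, ha⟩
        · exact Or.inr ⟨q, hq, ha⟩
    · refine Or.inl ⟨_, Multiset.eq_replicate_of_mem fun x hx => ?_⟩
      rw [Multiset.mem_filter] at hx
      exact h x hx.1 hx.2
  rcases key with ⟨t, ht⟩ | ⟨q, hq, h⟩
  · rw [ht] at hs
    rcases (show t = 0 ∨ t = 1 ∨ 2 ≤ t by omega) with rfl | rfl | h
    · rw [hs]
      exact graceful_zero.add_all_even (by simpa using graceful_four) hE
    · rw [hs]
      refine graceful_three_add_even hE ?_ ?_
      · rintro rfl
        exact h3 hs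
      · rintro rfl
        exact h23 (hs.trans (add_comm _ _))
    · rw [hs]
      exact (graceful_triangles h).add_all_even (graceful_triangles_four h) hE
  · rw [hs, h]
    exact (graceful_odd hq).add_all_even (graceful_odd_four hq) hE

/-! ### Isomorphisms and the two exceptional digraphs -/

theorem circuitUnion_adj {m : ℕ} {k : Fin m → ℕ} {i j : Fin m} {x : Fin (k i)} {y : Fin (k j)} :
    (circuitUnion k).Adj ⟨i, x⟩ ⟨j, y⟩ ↔ i = j ∧ (y : ℕ) = ((x : ℕ) + 1) % k i := by
  constructor
  · rintro ⟨l, a, b, h, h1, h2⟩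
    cases h1
    cases h2
    exact ⟨rfl, h⟩
  · rintro ⟨rfl, h⟩
    exact ⟨i, x, y, h, rfl, rfl⟩

theorem circuitUnion_isIso {m m' : ℕ} {k : Fin m → ℕ} {k' : Fin m' → ℕ} (e : Fin m ≃ Fin m')
    (h : ∀ i, k i = k' (e i)) : (circuitUnion k).IsIso (circuitUnion k') := by
  refine ⟨⟨Equiv.sigmaCongr e fun i => finCongr (h i), ?_⟩⟩
  rintro ⟨i, x⟩ ⟨j, y⟩
  change (circuitUnion k').Adj ⟨e i, finCongr (h i) x⟩ ⟨e j, finCongr (h j) y⟩ ↔ _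
  simp only [circuitUnion_adj, e.injective.eq_iff, ← h, finCongr_apply, Fin.val_cast]

theorem circuitUnion_isIso_circuit {k : Fin 1 → ℕ} {n : ℕ} (h : k 0 = n) :
    (circuitUnion k).IsIso (circuit n) := by
  subst h
  refine ⟨⟨⟨fun v => finCongr (congrArg k (Subsingleton.elim _ _)) v.2, fun x => ⟨0, x⟩, ?_, ?_⟩,
    ?_⟩⟩
  · rintro ⟨i, x⟩
    obtain rfl := Subsingleton.elim i 0
    rfl
  · intro x; rfl
  · rintro ⟨i, x⟩ ⟨j, y⟩
    obtain rfl := Subsingleton.elim i 0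
    obtain rfl := Subsingleton.elim j 0
    simp [circuitUnion_adj, circuit]

theorem not_hasGracefulDifferenceLabeling_circuit_three :
    ¬ (circuit 3).HasGracefulDifferenceLabeling := by
  rintro ⟨f, hf, hd⟩
  have hr : ∀ v, 1 ≤ f v ∧ f v ≤ 3 := fun v => by simpa using hf.mapsTo (Set.mem_univ v)
  have hi : Function.Injective f := Set.injOn_univ.1 hf.injOn
  have h1 := hr 0
  have h2 := hr 1
  have h3 := hr 2
  have h01 := hi.ne (show (0 : Fin 3) ≠ 1 by decide)
  have h02 := hi.ne (show (0 : Fin 3) ≠ 2 by decide)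
  have h12 := hi.ne (show (1 : Fin 3) ≠ 2 by decide)
  have d1 := hd 0 1 1 2 rfl rfl
  have d2 := hd 0 1 2 0 rfl rfl
  have d3 := hd 1 2 2 0 rfl rfl
  simp at d1 d2 d3
  omega

theorem no_labels_two_three : ∀ a ∈ Finset.Icc (1 : ℕ) 5, ∀ b ∈ Finset.Icc (1 : ℕ) 5, a ≠ b →
    ∀ c ∈ Finset.Icc (1 : ℕ) 5, ∀ d ∈ Finset.Icc (1 : ℕ) 5, ∀ e ∈ Finset.Icc (1 : ℕ) 5,
    [a, b, c, d, e].Nodup →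
    ¬ [(b : ℤ) - (a : ℤ), (a : ℤ) - b, (d : ℤ) - c, (e : ℤ) - d, (c : ℤ) - e].Nodup := by
  decide +kernel

theorem not_hasGracefulDifferenceLabeling_circuitUnion_two_three :
    ¬ (circuitUnion ![2, 3]).HasGracefulDifferenceLabeling := by
  rintro ⟨f, hf, hd⟩
  have hc : Nat.card (Σ i, Fin (![2, 3] i)) = 5 := by simp [Fin.sum_univ_two]
  have hr : ∀ v, f v ∈ Finset.Icc 1 5 := fun v => by
    simpa [hc] using hf.mapsTo (Set.mem_univ v)
  have hi : Function.Injective f := Set.injOn_univ.1 hf.injOn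
  let a : Σ i, Fin (![2, 3] i) := ⟨0, ⟨0, by decide⟩⟩
  let b : Σ i, Fin (![2, 3] i) := ⟨0, ⟨1, by decide⟩⟩
  let c : Σ i, Fin (![2, 3] i) := ⟨1, ⟨0, by decide⟩⟩
  let d : Σ i, Fin (![2, 3] i) := ⟨1, ⟨1, by decide⟩⟩
  let e : Σ i, Fin (![2, 3] i) := ⟨1, ⟨2, by decide⟩⟩
  have hn : [a, b, c, d, e].Nodup := by decide
  have hab : (circuitUnion ![2, 3]).Adj a b := circuitUnion_adj.2 ⟨rfl, rfl⟩
  have hba : (circuitUnion ![2, 3]).Adj b a := circuitUnion_adj.2 ⟨rfl, rfl⟩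
  have hcd : (circuitUnion ![2, 3]).Adj c d := circuitUnion_adj.2 ⟨rfl, rfl⟩
  have hde : (circuitUnion ![2, 3]).Adj d e := circuitUnion_adj.2 ⟨rfl, rfl⟩
  have hec : (circuitUnion ![2, 3]).Adj e c := circuitUnion_adj.2 ⟨rfl, rfl⟩
  refine no_labels_two_three (f a) (hr _) (f b) (hr _) (hi.ne (by decide)) (f c) (hr _) (f d)
    (hr _) (f e) (hr _) (hn.map hi) ?_
  let arcs : List ((Σ i, Fin (![2, 3] i)) × (Σ i, Fin (![2, 3] i))) :=
    [(a, b), (b, a), (c, d), (d, e), (e, c)]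
  have harcs : ∀ x ∈ arcs, (circuitUnion ![2, 3]).Adj x.1 x.2 := by
    intro x hx
    simp only [arcs, List.mem_cons, List.not_mem_nil, or_false] at hx
    rcases hx with rfl | rfl | rfl | rfl | rfl <;> assumption
  have hna : arcs.Nodup := by decide
  refine List.Nodup.map_on (f := fun x => (f x.2 : ℤ) - f x.1) ?_ hna
  intro x hx y hy hxy
  obtain ⟨h1, h2⟩ := hd _ _ _ _ (harcs x hx) (harcs y hy) hxy
  exact Prod.ext h1 h2

end Digraph

theorem mainTheorem1 {V : Type*} [Finite V] (G : Digraph V)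
    {m : ℕ} (k : Fin m → ℕ) (hk : ∀ i, 2 ≤ k i)
    (hG : G.IsIso (Digraph.circuitUnion k))
    (hodd : (∀ i j, Odd (k i) → Odd (k j) → i = j) ∨ (∀ i, Odd (k i) → k i = 3)) :
    G.HasGracefulDifferenceLabeling ↔
      ¬ G.IsIso (Digraph.circuit 3) ∧ ¬ G.IsIso (Digraph.circuitUnion ![2, 3]) := by
  constructor
  · intro h
    exact ⟨fun h' => Digraph.not_hasGracefulDifferenceLabeling_circuit_three (h.of_isIso h'.symm),
      fun h' => Digraph.not_hasGracefulDifferenceLabeling_circuitUnion_two_three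
        (h.of_isIso h'.symm)⟩
  · rintro ⟨h3, h23⟩
    refine .of_isIso hG (Digraph.Graceful.circuitUnion
      (Digraph.graceful_of_multiset ?_ ?_ ?_ ?_))
    · intro x hx
      obtain ⟨i, -, rfl⟩ := Multiset.mem_map.1 hx
      exact hk i
    · refine hodd.imp (fun h => ?_) fun h x hx hxo => ?_
      · rw [Multiset.filter_map, Multiset.card_map]
        have hc : (Finset.univ.filter (Odd ∘ k)).card ≤ 1 :=
          Finset.card_le_one.2 fun i hi j hj =>
            h i j (Finset.mem_filter.1 hi).2 (Finset.mem_filter.1 hj).2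
        exact hc
      · obtain ⟨i, -, rfl⟩ := Multiset.mem_map.1 hx
        exact h i hxo
    · intro hs
      obtain rfl : m = 1 := by simpa using congrArg Multiset.card hs
      exact h3 (hG.trans (Digraph.circuitUnion_isIso_circuit (by simpa using hs)))
    · intro hs
      obtain rfl : m = 2 := by simpa using congrArg Multiset.card hs
      have hs' : ({k 0, k 1} : Multiset ℕ) = {2, 3} := by
        rw [← hs]; rfl
      have h0 : k 0 = 2 ∨ k 0 = 3 := by
        have : k 0 ∈ ({2, 3} : Multiset ℕ) := by rw [← hs']; simp
        simpa using this
      have hsum : k 0 + k 1 = 5 := by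
        have := congrArg Multiset.sum hs'
        simpa using this
      rcases h0 with h0 | h0
      · refine h23 (hG.trans (Digraph.circuitUnion_isIso (Equiv.refl _) ?_))
        intro i
        fin_cases i
        · exact h0
        · show k 1 = 3
          omega
      -- The multiset forgets the order of the lengths, so `3, 2` has to be swapped into `2, 3`.
      · refine h23 (hG.trans (Digraph.circuitUnion_isIso (Equiv.swap 0 1) ?_))
        intro i
        fin_cases i
        · exact h0
        · show k 1 = 2
          omega
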